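/- Let $\mathbb G$ be a countable set, let $A$ be a bounded self-adjoint operator on the complex Hilbert space $\ell^2(\mathbb G)$, and let $\{V(x)\}_{x\in\mathbb G}$ be real random variables on a probability space $(\Omega,\mathcal B,\mathbb P)$. Let $H(\omega)=A+V(\omega)$, where $V(\omega)$ acts as multiplication by $V(\cdot\,;\omega)$ on its maximal domain; this is a (possibly unbounded) self-adjoint operator. For $x,y\in\mathbb G$ and $z\in\mathbb C\setminus\mathbb R$ put $G(x,y;z;\omega)=\langle\delta_x,(H(\omega)-z)^{-1}\delta_y\rangle$, and for $E\in\mathbb R$ put $$\gamma_x(E;\omega)=\lim_{\eta\downarrow 0}\ \sum_{y\in\mathbb G}|G(x,y;E+i\eta;\omega)|^2\ \in[0,\infty].$$ Assume: 1. (K-property) every $F:\Omega\to\mathbb R$ that is, for each finite $\Lambda\subset\mathbb G$, measurable with respect to the $\sigma$-algebra generated by $\{V(y)\}_{y\notin\Lambda}$, is almost surely constant; 2. for each $x\in\mathbb G$, the regular conditional distribution of $V(x)$ given $\{V(y)\}_{y\ne x}$ is almost surely continuous, i.e. it has no atoms. Then for every $x\in\mathbb G$: the limit defining $\gamma_x(E;\omega)$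 exists in $[0,\infty]$ for all $\omega\in\Omega$ and $E\in\mathbb R$; the set $\{\omega:\gamma_x(E;\omega)<\infty\}$ is measurable for every $E\in\mathbb R$; and for Lebesgue-almost every $E\in\mathbb R$, $$\mathbb P\bigl(\gamma_x(E)<\infty\bigr)\in\{0,1\}.$$ -/

import Mathlib

open MeasureTheory ProbabilityTheory Filter Topology
open scoped ENNReal

noncomputable section

namespace SimonWolff

/-- The Hilbert space `ℓ²(G)` of square-summable complex functions on the set `G`. -/
abbrev Ell2 (G : Type*) : Type _ := lp (fun _ : G => ℂ) 2

section Operators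

variable {G : Type*}

open Classical in
/-- The canonical basis vector `δ_x` of `ℓ²(G)`. -/
def delta (x : G) : Ell2 G := lp.single 2 x 1

/-- The (in general unbounded) operator of multiplication by the real function `v`, on its maximal
domain `{ψ ∈ ℓ²(G) | v ψ ∈ ℓ²(G)}`. -/
def potentialOp (v : G → ℝ) : Ell2 G →ₗ.[ℂ] Ell2 G where
  domain :=
    { carrier := {ψ | Memℓp (fun x => (v x : ℂ) * ψ x) 2}
      add_mem' := by
        intro ψ φ hψ hφ
        have h := Memℓp.add hψ hφ
        have he : (fun x => (v x : ℂ) * (ψ + φ) x)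
            = (fun x => (v x : ℂ) * ψ x) + fun x => (v x : ℂ) * φ x := by
          funext x
          simp [mul_add]
        change Memℓp (fun x => (v x : ℂ) * (ψ + φ) x) 2
        rwa [he]
      zero_mem' := by
        have he : (fun x => (v x : ℂ) * (0 : Ell2 G) x) = 0 := by
          funext x
          simp
        change Memℓp (fun x => (v x : ℂ) * (0 : Ell2 G) x) 2
        rw [he]
        exact zero_memℓp
      smul_mem' := by
        intro c ψ hψ
        have h := Memℓp.const_smul hψ c
        have he : (fun x => (v x : ℂ) * (c • ψ) x) = c • fun x => (v x : ℂ) * ψ x := by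
          funext x
          simp [mul_left_comm]
        change Memℓp (fun x => (v x : ℂ) * (c • ψ) x) 2
        rwa [he] }
  toFun :=
    { toFun := fun ψ => ⟨fun x => (v x : ℂ) * (ψ : Ell2 G) x, ψ.2⟩
      map_add' := by
        intro ψ φ
        ext x
        exact mul_add _ _ _
      map_smul' := by
        intro c ψ
        ext x
        exact mul_left_comm _ _ _ }

/-- The operator `H = A + V` on `ℓ²(G)`, where `A` is bounded and `V` is multiplication by `v`;
its domain is that of the multiplication operator. -/
def hamiltonian (A : Ell2 G →L[ℂ] Ell2 G) (v : G → ℝ) : Ell2 G →ₗ.[ℂ] Ell2 G :=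
  (A : Ell2 G →ₗ[ℂ] Ell2 G) +ᵥ potentialOp v

/-- `R` is the bounded inverse of `T - z`: it maps `ℓ²(G)` into the domain of `T`, and it is a
right and a left inverse of `T - z`. -/
def IsResolventAt (T : Ell2 G →ₗ.[ℂ] Ell2 G) (z : ℂ) (R : Ell2 G →L[ℂ] Ell2 G) : Prop :=
  (∀ φ : Ell2 G, ∃ h : R φ ∈ T.domain, T ⟨R φ, h⟩ - z • R φ = φ) ∧
    ∀ ψ : T.domain, R (T ψ - z • (ψ : Ell2 G)) = ψ

open Classical in
/-- The resolvent `(T - z)⁻¹`, as a bounded operator on `ℓ²(G)` (by convention `0` if `z` lies in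
the spectrum of `T`). -/
def resolventOp (T : Ell2 G →ₗ.[ℂ] Ell2 G) (z : ℂ) : Ell2 G →L[ℂ] Ell2 G :=
  if h : ∃ R, IsResolventAt T z R then h.choose else 0

/-- There is at most one resolvent. -/
theorem IsResolventAt.unique {T : Ell2 G →ₗ.[ℂ] Ell2 G} {z : ℂ} {R R' : Ell2 G →L[ℂ] Ell2 G}
    (h : IsResolventAt T z R) (h' : IsResolventAt T z R') : R = R' := by
  ext1 φ
  obtain ⟨hd, he⟩ := h'.1 φ
  have := h.2 ⟨R' φ, hd⟩
  rw [he] at this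
  exact this

theorem IsResolventAt.resolventOp_eq {T : Ell2 G →ₗ.[ℂ] Ell2 G} {z : ℂ}
    {R : Ell2 G →L[ℂ] Ell2 G} (h : IsResolventAt T z R) : resolventOp T z = R := by
  have hex : ∃ R, IsResolventAt T z R := ⟨R, h⟩
  rw [resolventOp, dif_pos hex]
  exact hex.choose_spec.unique h

theorem im_inner_potentialOp (v : G → ℝ) (ψ : (potentialOp v).domain) :
    (inner ℂ (ψ : Ell2 G) (potentialOp v ψ)).im = 0 := by
  have h := Complex.hasSum_im (lp.hasSum_inner (𝕜 := ℂ) (ψ : Ell2 G) (potentialOp v ψ))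
  have h0 : (fun i => (inner ℂ ((ψ : Ell2 G) i) ((potentialOp v ψ : Ell2 G) i)).im)
      = fun _ => 0 := by
    funext i
    have : (potentialOp v ψ : Ell2 G) i = (v i : ℂ) * (ψ : Ell2 G) i := rfl
    rw [this]
    simp
    ring
  rw [h0] at h
  exact h.unique hasSum_zero

/-- The basic lower bound for a self-adjoint operator: `|Im z| ‖ψ‖ ≤ ‖(H - z) ψ‖`. -/
theorem abs_im_mul_norm_le {A : Ell2 G →L[ℂ] Ell2 G} (hA : IsSelfAdjoint A) (v : G → ℝ) (z : ℂ)
    (ψ : (hamiltonian A v).domain) :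
    |z.im| * ‖(ψ : Ell2 G)‖ ≤ ‖hamiltonian A v ψ - z • (ψ : Ell2 G)‖ := by
  have h1 : (inner ℂ (ψ : Ell2 G) (hamiltonian A v ψ - z • (ψ : Ell2 G))).im
      = - (z.im * ‖(ψ : Ell2 G)‖ ^ 2) := by
    have hd : (ψ : Ell2 G) ∈ (potentialOp v).domain := ψ.2
    have hH : hamiltonian A v ψ = A (ψ : Ell2 G) + potentialOp v ⟨ψ, hd⟩ := rfl
    have hVim : (inner ℂ (ψ : Ell2 G) (potentialOp v ⟨ψ, hd⟩)).im = 0 :=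
      im_inner_potentialOp v ⟨ψ, hd⟩
    have hAim : (inner ℂ (ψ : Ell2 G) (A (ψ : Ell2 G))).im = 0 :=
      hA.isSymmetric.im_inner_self_apply (ψ : Ell2 G)
    rw [hH, inner_sub_right, inner_add_right, inner_smul_right, inner_self_eq_norm_sq_to_K,
      Complex.sub_im, Complex.add_im, hAim, hVim]
    simp [← Complex.ofReal_pow]
  have h2 : |z.im| * ‖(ψ : Ell2 G)‖ ^ 2
      ≤ ‖(ψ : Ell2 G)‖ * ‖hamiltonian A v ψ - z • (ψ : Ell2 G)‖ := by
    have h3 := (Complex.abs_im_le_norm _).trans (norm_inner_le_norm (𝕜 := ℂ) (ψ : Ell2 G)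
      (hamiltonian A v ψ - z • (ψ : Ell2 G)))
    rw [h1, abs_neg, abs_mul, abs_of_nonneg (sq_nonneg ‖(ψ : Ell2 G)‖)] at h3
    exact h3
  rcases eq_or_lt_of_le (norm_nonneg (ψ : Ell2 G)) with h0 | h0
  · rw [← h0]
    simp
  · nlinarith

theorem memℓp_mul_of_bounded {w : G → ℂ} {C : ℝ} (hw : ∀ x, ‖w x‖ ≤ C) (ψ : Ell2 G) :
    Memℓp (fun x => w x * ψ x) 2 := by
  refine Memℓp.mono (((lp.memℓp ψ).norm).const_mul C) fun x => ?_
  rw [norm_mul]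
  gcongr
  exact hw x

theorem exists_diagonal (w : G → ℂ) (C : ℝ) (hw : ∀ x, ‖w x‖ ≤ C) :
    ∃ R : Ell2 G →L[ℂ] Ell2 G, ∀ ψ x, R ψ x = w x * ψ x := by
  let L : Ell2 G →ₗ[ℂ] Ell2 G :=
    { toFun := fun ψ => ⟨fun x => w x * ψ x, memℓp_mul_of_bounded hw ψ⟩
      map_add' := by
        intro ψ φ
        ext x
        exact mul_add _ _ _
      map_smul' := by
        intro c ψ
        ext x
        exact mul_left_comm _ _ _ }
  refine ⟨L.mkContinuous |C| fun ψ => ?_, fun ψ x => rfl⟩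
  have h := lp.norm_mono (p := 2) (by simp) (x := L ψ) (y := ((C : ℂ) • ψ : Ell2 G)) fun x => by
    change ‖w x * ψ x‖ ≤ ‖(C : ℂ) * ψ x‖
    rw [norm_mul, norm_mul, Complex.norm_real]
    gcongr
    exact (hw x).trans (le_abs_self C)
  rwa [norm_smul, Complex.norm_real] at h

/-- If `A` is bounded and self-adjoint, then the resolvent of `A + V` exists at every non-real
`z`, so that the convention in `resolventOp` is not used there. -/
theorem isResolventAt_resolventOp {A : Ell2 G →L[ℂ] Ell2 G} (hA : IsSelfAdjoint A) (v : G → ℝ)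
    {z : ℂ} (hz : z.im ≠ 0) :
    IsResolventAt (hamiltonian A v) z (resolventOp (hamiltonian A v) z) := by
  have hz0 : 0 < |z.im| := abs_pos.2 hz
  have hlow : ∀ x, |z.im| ≤ ‖(v x : ℂ) - z‖ := fun x => by
    simpa using Complex.abs_im_le_norm ((v x : ℂ) - z)
  have hne : ∀ x, (v x : ℂ) - z ≠ 0 := fun x => norm_pos_iff.1 (hz0.trans_le (hlow x))
  have hne' : ∀ x, (v x : ℂ) - (starRingEnd ℂ) z ≠ 0 := fun x h => by
    apply hne x
    have := congrArg (starRingEnd ℂ) h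
    simpa using this
  obtain ⟨R₀, hR₀⟩ := exists_diagonal (fun x => ((v x : ℂ) - z)⁻¹) |z.im|⁻¹ fun x => by
    rw [norm_inv]
    exact inv_anti₀ hz0 (hlow x)
  have hdom : ∀ χ, R₀ χ ∈ (potentialOp v).domain := fun χ => by
    have he : (fun x => (v x : ℂ) * R₀ χ x) = ⇑(χ + z • R₀ χ) := by
      funext x
      simp only [lp.coeFn_add, lp.coeFn_smul, Pi.add_apply, Pi.smul_apply, smul_eq_mul, hR₀]
      field_simp [hne x]
      ring
    change Memℓp (fun x => (v x : ℂ) * R₀ χ x) 2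
    rw [he]
    exact lp.memℓp _
  have hV : ∀ χ, potentialOp v ⟨R₀ χ, hdom χ⟩ = χ + z • R₀ χ := fun χ => by
    ext x
    change (v x : ℂ) * R₀ χ x = _
    simp only [lp.coeFn_add, lp.coeFn_smul, Pi.add_apply, Pi.smul_apply, smul_eq_mul, hR₀]
    field_simp [hne x]
    ring
  let S : Ell2 G →L[ℂ] Ell2 G := 1 + A ∘L R₀
  have hS : ∀ χ, hamiltonian A v ⟨R₀ χ, hdom χ⟩ - z • R₀ χ = S χ := fun χ => by
    have : hamiltonian A v ⟨R₀ χ, hdom χ⟩ = A (R₀ χ) + potentialOp v ⟨R₀ χ, hdom χ⟩ := rfl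
    rw [this, hV]
    simp [S]
    abel
  have hanti : ∀ χ, ‖χ‖ ≤ (1 + ‖A‖ * |z.im|⁻¹) * ‖S χ‖ := fun χ => by
    have h1 := abs_im_mul_norm_le hA v z ⟨R₀ χ, hdom χ⟩
    rw [hS] at h1
    have h2 : ‖R₀ χ‖ ≤ |z.im|⁻¹ * ‖S χ‖ := by
      rw [inv_mul_eq_div, le_div_iff₀ hz0, mul_comm]
      exact h1
    have h3 : χ = S χ - A (R₀ χ) := by simp [S]
    calc ‖χ‖ = ‖S χ - A (R₀ χ)‖ := by rw [← h3]
      _ ≤ ‖S χ‖ + ‖A (R₀ χ)‖ := norm_sub_le _ _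
      _ ≤ ‖S χ‖ + ‖A‖ * (|z.im|⁻¹ * ‖S χ‖) := by
        gcongr
        exact (A.le_opNorm _).trans (by gcongr)
      _ = _ := by ring
  have hdense : S.range.topologicalClosure = ⊤ := by
    rw [Submodule.topologicalClosure_eq_top_iff, Submodule.eq_bot_iff]
    intro φ hφ
    have horth : ∀ χ, inner ℂ χ φ + inner ℂ (R₀ χ) (A φ) = 0 := fun χ => by
      have h := (Submodule.mem_orthogonal _ _).1 hφ (S χ) ⟨χ, rfl⟩
      have h2 : inner ℂ (A (R₀ χ)) φ = inner ℂ (R₀ χ) (A φ) := hA.isSymmetric (R₀ χ) φ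
      rw [← h2, ← inner_add_left]
      simpa [S] using h
    have hpt : ∀ x, ((v x : ℂ) - (starRingEnd ℂ) z) * φ x = - A φ x := fun x => by
      classical
      have h := horth (lp.single 2 x 1)
      have hs : R₀ (lp.single 2 x 1) = lp.single 2 x (((v x : ℂ) - z)⁻¹) := by
        ext y
        rw [hR₀]
        by_cases hxy : y = x
        · subst hxy
          simp
        · simp [hxy]
      rw [hs, lp.inner_single_left, lp.inner_single_left] at h
      simp only [RCLike.inner_apply, map_one, mul_one, map_inv₀, map_sub, Complex.conj_ofReal] at h
      have h' := hne' x
      field_simp at h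
      linear_combination h
    have hφd : φ ∈ (potentialOp v).domain := by
      have he : (fun x => (v x : ℂ) * φ x) = ⇑((starRingEnd ℂ) z • φ - A φ) := by
        funext x
        simp only [lp.coeFn_sub, lp.coeFn_smul, Pi.sub_apply, Pi.smul_apply, smul_eq_mul]
        linear_combination hpt x
      change Memℓp (fun x => (v x : ℂ) * φ x) 2
      rw [he]
      exact lp.memℓp _
    have hz' : hamiltonian A v ⟨φ, hφd⟩ - (starRingEnd ℂ) z • φ = 0 := by
      ext x
      change A φ x + (v x : ℂ) * φ x - (starRingEnd ℂ) z * φ x = 0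
      linear_combination hpt x
    have h := abs_im_mul_norm_le hA v ((starRingEnd ℂ) z) ⟨φ, hφd⟩
    rw [hz', norm_zero, Complex.conj_im, abs_neg] at h
    have hn : ‖φ‖ ≤ 0 := nonpos_of_mul_nonpos_right h hz0
    exact norm_le_zero_iff.1 hn
  have hpos : 0 ≤ 1 + ‖A‖ * |z.im|⁻¹ := by positivity
  have hbij : Function.Bijective S :=
    (ContinuousLinearMap.bijective_iff_dense_range_and_antilipschitz S).2
      ⟨hdense, ⟨1 + ‖A‖ * |z.im|⁻¹, hpos⟩, S.antilipschitz_of_bound fun χ => hanti χ⟩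
  let e := ContinuousLinearEquiv.ofBijective S (LinearMap.ker_eq_bot.2 hbij.1)
    (LinearMap.range_eq_top.2 hbij.2)
  let R : Ell2 G →L[ℂ] Ell2 G := R₀ ∘L (e.symm : Ell2 G →L[ℂ] Ell2 G)
  have hright : ∀ φ, hamiltonian A v ⟨R φ, hdom (e.symm φ)⟩ - z • R φ = φ := fun φ =>
    (hS (e.symm φ)).trans (e.apply_symm_apply φ)
  have hR : IsResolventAt (hamiltonian A v) z R := by
    refine ⟨fun φ => ⟨hdom _, hright φ⟩, fun ψ => ?_⟩
    have hd : R (hamiltonian A v ψ - z • (ψ : Ell2 G)) ∈ (hamiltonian A v).domain := hdom _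
    have h1 := hright (hamiltonian A v ψ - z • (ψ : Ell2 G))
    have h2 := abs_im_mul_norm_le hA v z
      (⟨R (hamiltonian A v ψ - z • (ψ : Ell2 G)), hd⟩ - ψ)
    have h3 : hamiltonian A v (⟨R (hamiltonian A v ψ - z • (ψ : Ell2 G)), hd⟩ - ψ)
        - z • ((⟨R (hamiltonian A v ψ - z • (ψ : Ell2 G)), hd⟩ - ψ :
          (hamiltonian A v).domain) : Ell2 G) = 0 := by
      rw [LinearPMap.map_sub, Submodule.coe_sub, smul_sub, sub_sub_sub_comm, h1, sub_self]
    rw [h3, norm_zero] at h2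
    have hn := norm_le_zero_iff.1 (nonpos_of_mul_nonpos_right h2 hz0)
    exact sub_eq_zero.1 hn
  rw [hR.resolventOp_eq]
  exact hR

/-- The Green function `G(x, y; z) = ⟨δ_x, (A + V - z)⁻¹ δ_y⟩`. -/
def green (A : Ell2 G →L[ℂ] Ell2 G) (v : G → ℝ) (x y : G) (z : ℂ) : ℂ :=
  inner ℂ (delta x) (resolventOp (hamiltonian A v) z (delta y))

/-- The sum `∑_y |G(x, y; E + i η)|²`, as an element of `[0, ∞]`. -/
def greenSqSum (A : Ell2 G →L[ℂ] Ell2 G) (v : G → ℝ) (x : G) (E η : ℝ) : ℝ≥0∞ :=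
  ∑' y, ‖green A v x y ((E : ℂ) + (η : ℂ) * Complex.I)‖ₑ ^ 2

/-- `γ_x(E) = lim_{η ↓ 0} ∑_y |G(x, y; E + i η)|²`, as an element of `[0, ∞]`. -/
def gammaFn (A : Ell2 G →L[ℂ] Ell2 G) (v : G → ℝ) (x : G) (E : ℝ) : ℝ≥0∞ :=
  limUnder (𝓝[>] (0 : ℝ)) fun η => greenSqSum A v x E η

end Operators

section Probability

variable {G Ω : Type*}

/-- The σ-algebra on `Ω` generated by the random variables `V y`, `y ∈ Λ`. -/
abbrev sigmaOn (V : G → Ω → ℝ) (Λ : Set G) : MeasurableSpace Ω :=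
  ⨆ y ∈ Λ, MeasurableSpace.comap (V y) inferInstance

/-- `F` is measurable at infinity: for each finite `Λ`, it is measurable with respect to the
σ-algebra generated by the variables `V y`, `y ∉ Λ`. -/
def MeasurableAtInfinity (V : G → Ω → ℝ) (F : Ω → ℝ) : Prop :=
  ∀ Λ : Set G, Λ.Finite → Measurable[sigmaOn V Λᶜ] F

variable [MeasurableSpace Ω]

/-- The K-property: every random variable which is measurable at infinity is almost surely
constant. -/
def HasKProperty (V : G → Ω → ℝ) (P : Measure Ω) : Prop :=
  ∀ F : Ω → ℝ, MeasurableAtInfinity V F → ∃ c : ℝ, ∀ᵐ ω ∂P, F ω = c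

/-- For each `x`, the regular conditional distribution of `V x` conditioned on
`(V y)_{y ≠ x}` is almost surely continuous, i.e. has no atoms. -/
def HasContinuousConditionalLaws (V : G → Ω → ℝ) (P : Measure Ω) [IsFiniteMeasure P] : Prop :=
  ∀ x : G, ∀ᵐ ω ∂P, ∀ t : ℝ,
    condDistrib (V x) (fun ω' (y : {y : G // y ≠ x}) => V y ω') P (fun y => V y ω) {t} = 0

end Probability

end SimonWolff

end

/-
The function `ψ_η = (H - E + i η)⁻¹ δ_x` has squared norm `∑_y |G(x, y; E + i η)|²`, which increases
as `η ↓ 0`; if it stays bounded, then the identity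
`(η + η') ‖ψ_η - ψ_η'‖² = (η - η') (‖ψ_η'‖² - ‖ψ_η‖²)` makes `ψ_η` converge. Hence `γ_x(E) < ∞`
if and only if `δ_x` lies in the range of `A + V - E`. Changing `V` at one site is a rank-one
perturbation, so along each line parallel to a coordinate axis the potentials with this property, or
those without it, form a set of at most one point. As the conditional laws have no atoms, such a set
of potentials agrees almost surely with one that does not depend on a given coordinate. Doing this
successively for all coordinates yields an event measurable at infinity, to which the K-property
applies.
-/

namespace SimonWolff

section Solutions

variable {G : Type*} {A : Ell2 G →L[ℂ] Ell2 G} {v : G → ℝ} {z z' : ℂ} {φ φ' ψ ψ' : Ell2 G}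

/-- `ψ` solves `(A + v - z) ψ = φ`. The equation is read site by site; this already puts `ψ` in the
maximal domain of multiplication by `v`, because `v ψ = φ - A ψ + z ψ` is square-summable. -/
def Solves (A : Ell2 G →L[ℂ] Ell2 G) (v : G → ℝ) (z : ℂ) (φ ψ : Ell2 G) : Prop :=
  ∀ y, A ψ y + (v y : ℂ) * ψ y - z * ψ y = φ y

theorem solves_iff :
    Solves A v z φ ψ ↔
      ∃ h : ψ ∈ (hamiltonian A v).domain, hamiltonian A v ⟨ψ, h⟩ - z • ψ = φ := by
  refine ⟨fun h => ?_, fun ⟨_, h⟩ y => congrArg (fun χ : Ell2 G => χ y) h⟩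
  have hdom : Memℓp (fun y => (v y : ℂ) * ψ y) 2 := by
    convert lp.memℓp (φ - A ψ + z • ψ) using 1
    ext y
    simp only [lp.coeFn_add, lp.coeFn_sub, lp.coeFn_smul, Pi.add_apply, Pi.sub_apply,
      Pi.smul_apply, smul_eq_mul]
    linear_combination h y
  exact ⟨hdom, lp.ext (funext h)⟩

theorem Solves.sub (h : Solves A v z φ ψ) (h' : Solves A v z φ' ψ') :
    Solves A v z (φ - φ') (ψ - ψ') := by
  intro y
  simp only [map_sub, lp.coeFn_sub, Pi.sub_apply]
  linear_combination h y - h' y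

theorem Solves.smul (h : Solves A v z φ ψ) (c : ℂ) : Solves A v z (c • φ) (c • ψ) := by
  intro y
  simp only [map_smul, lp.coeFn_smul, Pi.smul_apply, smul_eq_mul]
  linear_combination c * h y

theorem Solves.of_tendsto {ι : Type*} {l : Filter ι} [l.NeBot] {f : ι → ℂ} {g : ι → Ell2 G}
    (hs : ∀ᶠ i in l, Solves A v (f i) φ (g i)) (hf : Tendsto f l (𝓝 z))
    (hg : Tendsto g l (𝓝 ψ)) : Solves A v z φ ψ := by
  intro y
  have hy : ∀ {h : ι → Ell2 G} {χ : Ell2 G}, Tendsto h l (𝓝 χ) →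
      Tendsto (fun i => h i y) l (𝓝 (χ y)) := fun hh =>
    ((lp.uniformContinuous_coe.continuous.tendsto _).comp hh).apply_nhds y
  have hlim := ((hy ((A.continuous.tendsto ψ).comp hg)).add ((hy hg).const_mul (v y : ℂ))).sub
    (hf.mul (hy hg))
  exact tendsto_nhds_unique hlim (tendsto_const_nhds.congr' (hs.mono fun i h => (h y).symm))

theorem Solves.inner_sub_inner (hA : IsSelfAdjoint A) (h : Solves A v z φ ψ)
    (h' : Solves A v z' φ' ψ') :
    inner ℂ φ ψ' - inner ℂ ψ φ' = (z' - (starRingEnd ℂ) z) * inner ℂ ψ ψ' := by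
  have hpot : inner ℂ (φ - A ψ + z • ψ) ψ' = inner ℂ ψ (φ' - A ψ' + z' • ψ') := by
    rw [lp.inner_eq_tsum, lp.inner_eq_tsum]
    refine tsum_congr fun y => ?_
    have hy : (φ - A ψ + z • ψ) y = v y * ψ y := by
      simp only [lp.coeFn_add, lp.coeFn_sub, lp.coeFn_smul, Pi.add_apply, Pi.sub_apply,
        Pi.smul_apply, smul_eq_mul]
      linear_combination -h y
    have hy' : (φ' - A ψ' + z' • ψ') y = v y * ψ' y := by
      simp only [lp.coeFn_add, lp.coeFn_sub, lp.coeFn_smul, Pi.add_apply, Pi.sub_apply,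
        Pi.smul_apply, smul_eq_mul]
      linear_combination -h' y
    rw [hy, hy', RCLike.inner_apply, RCLike.inner_apply, map_mul, Complex.conj_ofReal]
    ring
  have hsymm : inner ℂ (A ψ) ψ' = inner ℂ ψ (A ψ') := hA.isSymmetric ψ ψ'
  simp only [inner_add_left, inner_sub_left, inner_smul_left, inner_add_right, inner_sub_right,
    inner_smul_right] at hpot
  linear_combination hpot + hsymm

theorem Solves.im_inner_add_im_inner {E η η' : ℝ} (hA : IsSelfAdjoint A)
    (h : Solves A v (E - η * Complex.I) φ ψ) (h' : Solves A v (E - η' * Complex.I) φ ψ') :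
    (inner ℂ φ ψ').im + (inner ℂ φ ψ).im = -(η + η') * (inner ℂ ψ ψ').re := by
  have hcoeff : (E - η' * Complex.I) - (starRingEnd ℂ) (E - η * Complex.I) =
      (-(η + η') : ℝ) * Complex.I := by
    simp only [map_sub, map_mul, Complex.conj_ofReal, Complex.conj_I]
    push_cast
    ring
  have him := congrArg Complex.im (h.inner_sub_inner hA h')
  rwa [hcoeff, mul_assoc, Complex.im_ofReal_mul, Complex.I_mul_im, ← inner_conj_symm ψ φ,
    Complex.sub_im, Complex.conj_im, sub_neg_eq_add] at him

theorem Solves.norm_sub_sq_mul {E η η' : ℝ} (hA : IsSelfAdjoint A)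
    (h : Solves A v (E - η * Complex.I) φ ψ) (h' : Solves A v (E - η' * Complex.I) φ ψ') :
    (η + η') * ‖ψ - ψ'‖ ^ 2 = (η - η') * (‖ψ'‖ ^ 2 - ‖ψ‖ ^ 2) := by
  have hcross := h.im_inner_add_im_inner hA h'
  have hself := h.im_inner_add_im_inner hA h
  have hself' := h'.im_inner_add_im_inner hA h'
  have hnorm (χ : Ell2 G) : (inner ℂ χ χ).re = ‖χ‖ ^ 2 := inner_self_eq_norm_sq (𝕜 := ℂ) χ
  rw [hnorm] at hself hself'
  rw [norm_sub_sq (𝕜 := ℂ), RCLike.re_eq_complex_re]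
  linear_combination (-2) * hcross + hself + hself'

theorem Solves.norm_sub_sq_le {E η η' : ℝ} (hA : IsSelfAdjoint A) (hη' : 0 ≤ η') (hη : 0 < η)
    (hle : η' ≤ η) (h : Solves A v (E - η * Complex.I) φ ψ)
    (h' : Solves A v (E - η' * Complex.I) φ ψ') :
    ‖ψ - ψ'‖ ^ 2 ≤ ‖ψ'‖ ^ 2 - ‖ψ‖ ^ 2 := by
  rcases eq_or_ne ψ ψ' with rfl | hne
  · simp
  have hid := h.norm_sub_sq_mul hA h'
  have hd : 0 < ‖ψ - ψ'‖ ^ 2 := by have := norm_sub_pos_iff.2 hne; positivity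
  have hgain : 0 < ‖ψ'‖ ^ 2 - ‖ψ‖ ^ 2 :=
    pos_of_mul_pos_right (hid ▸ by positivity) (sub_nonneg.2 hle)
  refine le_of_mul_le_mul_left (hid.trans_le ?_) (by positivity : 0 < η + η')
  gcongr
  linarith

theorem Solves.norm_le_norm {E η η' : ℝ} (hA : IsSelfAdjoint A) (hη' : 0 ≤ η') (hη : 0 < η)
    (hle : η' ≤ η) (h : Solves A v (E - η * Complex.I) φ ψ)
    (h' : Solves A v (E - η' * Complex.I) φ ψ') : ‖ψ‖ ≤ ‖ψ'‖ :=
  le_of_sq_le_sq (sub_nonneg.1 ((sq_nonneg _).trans (h.norm_sub_sq_le hA hη' hη hle h')))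
    (norm_nonneg _)

end Solutions

section Resolvent

variable {G : Type*} {A : Ell2 G →L[ℂ] Ell2 G} {v : G → ℝ} {z : ℂ} {φ ψ : Ell2 G}

theorem solves_resolventOp (hA : IsSelfAdjoint A) (hz : z.im ≠ 0) (v : G → ℝ) (φ : Ell2 G) :
    Solves A v z φ (resolventOp (hamiltonian A v) z φ) :=
  solves_iff.2 ((isResolventAt_resolventOp hA v hz).1 φ)

theorem Solves.eq_resolventOp (hA : IsSelfAdjoint A) (hz : z.im ≠ 0) (h : Solves A v z φ ψ) :
    ψ = resolventOp (hamiltonian A v) z φ := by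
  obtain ⟨hdom, rfl⟩ := solves_iff.1 h
  exact ((isResolventAt_resolventOp hA v hz).2 ⟨ψ, hdom⟩).symm

theorem norm_resolventOp_apply_le (hA : IsSelfAdjoint A) (hz : z.im ≠ 0) (v : G → ℝ)
    (φ : Ell2 G) : ‖resolventOp (hamiltonian A v) z φ‖ ≤ |z.im|⁻¹ * ‖φ‖ := by
  obtain ⟨hdom, he⟩ := (isResolventAt_resolventOp hA v hz).1 φ
  rw [inv_mul_eq_div, le_div_iff₀' (abs_pos.2 hz)]
  simpa only [he] using abs_im_mul_norm_le hA v z ⟨_, hdom⟩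

theorem inner_resolventOp_left (hA : IsSelfAdjoint A) (hz : z.im ≠ 0) (v : G → ℝ)
    (φ φ' : Ell2 G) :
    inner ℂ (resolventOp (hamiltonian A v) z φ) φ' =
      inner ℂ φ (resolventOp (hamiltonian A v) ((starRingEnd ℂ) z) φ') := by
  have hz' : ((starRingEnd ℂ) z).im ≠ 0 := by simpa using hz
  have h := (solves_resolventOp hA hz v φ).inner_sub_inner hA (solves_resolventOp hA hz' v φ')
  rw [sub_self, zero_mul] at h
  exact (sub_eq_zero.1 h).symm

end Resolvent

section Gamma

variable {G : Type*} {A : Ell2 G →L[ℂ] Ell2 G}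

theorem inner_delta_left (x : G) (ψ : Ell2 G) : inner ℂ (delta x) ψ = ψ x := by
  classical
  have : delta x = (lp.single 2 x (1 : ℂ) : Ell2 G) := by unfold delta; congr
  rw [this, lp.inner_single_left]
  simp

theorem enorm_sq_eq_tsum (ψ : Ell2 G) : ‖ψ‖ₑ ^ 2 = ∑' y, ‖ψ y‖ₑ ^ 2 := by
  have h := lp.hasSum_norm (p := 2) (by simp) ψ
  simp only [ENNReal.toReal_ofNat, Real.rpow_ofNat] at h
  simp only [← ofReal_norm, ← ENNReal.ofReal_pow (norm_nonneg _)]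
  rw [← h.tsum_eq, ENNReal.ofReal_tsum_of_nonneg (fun _ => by positivity) h.summable]

/-- The vector `(A + v - E + i η)⁻¹ φ`, which regularizes the equation `(A + v - E) ψ = φ`. The sign
of `i η` is opposite to that in `greenSqSum` because summing `|G(x, y; E + i η)|²` over `y` gives
the squared norm of the adjoint resolvent applied to `δ_x`. -/
noncomputable def regularizedSolution (A : Ell2 G →L[ℂ] Ell2 G) (v : G → ℝ) (E : ℝ)
    (φ : Ell2 G) (η : ℝ) : Ell2 G :=
  resolventOp (hamiltonian A v) (E - η * Complex.I) φ

theorem solves_regularizedSolution (hA : IsSelfAdjoint A) (v : G → ℝ) (E : ℝ) (φ : Ell2 G)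
    {η : ℝ} (hη : η ≠ 0) : Solves A v (E - η * Complex.I) φ (regularizedSolution A v E φ η) :=
  solves_resolventOp hA (by simpa using hη) v φ

theorem greenSqSum_eq_enorm_sq (hA : IsSelfAdjoint A) (v : G → ℝ) (x : G) (E : ℝ) {η : ℝ}
    (hη : η ≠ 0) :
    greenSqSum A v x E η = ‖regularizedSolution A v E (delta x) η‖ₑ ^ 2 := by
  have him : ((E : ℂ) - η * Complex.I).im ≠ 0 := by simpa using hη
  have hconj : (starRingEnd ℂ) ((E : ℂ) - η * Complex.I) = E + η * Complex.I := by simp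
  rw [enorm_sq_eq_tsum, greenSqSum]
  refine tsum_congr fun y => ?_
  rw [green, ← hconj, ← inner_resolventOp_left hA him, ← inner_conj_symm, inner_delta_left,
    RCLike.enorm_conj, regularizedSolution]

theorem dist_regularizedSolution_le (hA : IsSelfAdjoint A) (v : G → ℝ) (E : ℝ) (φ : Ell2 G)
    {η η' : ℝ} (hη : 0 < η) (hη' : 0 < η') :
    dist (regularizedSolution A v E φ η) (regularizedSolution A v E φ η') ≤
      √(dist (‖regularizedSolution A v E φ η‖ ^ 2) (‖regularizedSolution A v E φ η'‖ ^ 2)) := by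
  wlog hle : η' ≤ η generalizing η η'
  · rw [dist_comm, dist_comm (_ ^ 2)]
    exact this hη' hη (le_of_not_ge hle)
  rw [dist_comm (_ ^ 2), dist_eq_norm, Real.dist_eq]
  exact Real.le_sqrt_of_sq_le <|
    ((solves_regularizedSolution hA v E φ hη.ne').norm_sub_sq_le hA hη'.le hη hle
      (solves_regularizedSolution hA v E φ hη'.ne')).trans (le_abs_self _)

theorem antitoneOn_greenSqSum (hA : IsSelfAdjoint A) (v : G → ℝ) (x : G) (E : ℝ) :
    AntitoneOn (greenSqSum A v x E) (Set.Ioi 0) := by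
  intro η' (hη' : 0 < η') η (hη : 0 < η) hle
  rw [greenSqSum_eq_enorm_sq hA v x E hη.ne', greenSqSum_eq_enorm_sq hA v x E hη'.ne']
  gcongr
  exact enorm_le_iff_norm_le.2 <| (solves_regularizedSolution hA v E _ hη.ne').norm_le_norm hA
    hη'.le hη hle (solves_regularizedSolution hA v E _ hη'.ne')

theorem tendsto_greenSqSum (hA : IsSelfAdjoint A) (v : G → ℝ) (x : G) (E : ℝ) :
    Tendsto (greenSqSum A v x E) (𝓝[>] 0) (𝓝 (gammaFn A v x E)) :=
  tendsto_nhds_limUnder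
    ⟨_, (antitoneOn_greenSqSum hA v x E).dual_right.tendsto_nhdsGT (OrderBot.bddBelow _)⟩

theorem exists_solves_of_tendsto_norm_sq (hA : IsSelfAdjoint A) {v : G → ℝ} {E : ℝ} {φ : Ell2 G}
    {c : ℝ}
    (h : Tendsto (fun η => ‖regularizedSolution A v E φ η‖ ^ 2) (𝓝[>] 0) (𝓝 c)) :
    ∃ ψ, Solves A v E φ ψ := by
  have hcauchy : Cauchy (map (regularizedSolution A v E φ) (𝓝[>] 0)) := by
    have hnorm := tendsto_uniformity_iff_dist_tendsto_zero.1 (cauchy_map_iff.1 h.cauchy_map).2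
    refine cauchy_map_iff.2 ⟨inferInstance, tendsto_uniformity_iff_dist_tendsto_zero.2 ?_⟩
    refine squeeze_zero' (.of_forall fun _ => dist_nonneg) ?_
      ((Real.continuous_sqrt.tendsto' 0 0 Real.sqrt_zero).comp hnorm)
    filter_upwards [prod_mem_prod self_mem_nhdsWithin self_mem_nhdsWithin] with p hp
    exact dist_regularizedSolution_le hA v E φ hp.1 hp.2
  obtain ⟨ψ, hψ⟩ := cauchy_map_iff_exists_tendsto.1 hcauchy
  have hz : Tendsto (fun η : ℝ => (E : ℂ) - η * Complex.I) (𝓝[>] 0) (𝓝 E) := by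
    have : Continuous fun η : ℝ => (E : ℂ) - η * Complex.I := by fun_prop
    simpa using (this.tendsto 0).mono_left nhdsWithin_le_nhds
  refine ⟨ψ, Solves.of_tendsto ?_ hz hψ⟩
  filter_upwards [self_mem_nhdsWithin] with η hη
  exact solves_regularizedSolution hA v E φ hη.ne'

theorem gammaFn_lt_top_iff (hA : IsSelfAdjoint A) (v : G → ℝ) (x : G) (E : ℝ) :
    gammaFn A v x E < ∞ ↔ ∃ ψ, Solves A v E (delta x) ψ := by
  refine ⟨fun h => exists_solves_of_tendsto_norm_sq hA (c := (gammaFn A v x E).toReal) ?_,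
    fun ⟨ψ, hψ⟩ => ?_⟩
  · refine ((ENNReal.tendsto_toReal h.ne).comp (tendsto_greenSqSum hA v x E)).congr' ?_
    filter_upwards [self_mem_nhdsWithin] with η hη
    simp [greenSqSum_eq_enorm_sq hA v x E (ne_of_gt hη)]
  · refine (le_of_tendsto (tendsto_greenSqSum hA v x E) ?_).trans_lt
      (ENNReal.pow_lt_top (n := 2) (enorm_lt_top (x := ψ)))
    filter_upwards [self_mem_nhdsWithin] with η hη
    rw [greenSqSum_eq_enorm_sq hA v x E (ne_of_gt hη)]
    gcongr
    exact enorm_le_iff_norm_le.2 <|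
      (solves_regularizedSolution hA v E _ (ne_of_gt hη)).norm_le_norm hA le_rfl hη (le_of_lt hη)
        (by simpa using hψ)

end Gamma

section Measurability

variable {G : Type*} {A : Ell2 G →L[ℂ] Ell2 G} {z : ℂ}

theorem delta_apply_self (x : G) : delta x x = 1 := by
  classical
  simp [delta]

theorem delta_apply_of_ne {x y : G} (h : y ≠ x) : delta x y = 0 := by
  classical
  simp [delta, h]

theorem solves_delta (A : Ell2 G →L[ℂ] Ell2 G) (v : G → ℝ) (z : ℂ) (y : G) :
    Solves A v z (A (delta y) + ((v y : ℂ) - z) • delta y) (delta y) := by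
  intro x
  simp only [lp.coeFn_add, lp.coeFn_smul, Pi.add_apply, Pi.smul_apply, smul_eq_mul]
  rcases eq_or_ne x y with rfl | hx
  · ring
  · simp [delta_apply_of_ne hx]

theorem resolventOp_apply_delta_image (hA : IsSelfAdjoint A) (hz : z.im ≠ 0) (v w : G → ℝ)
    (y : G) :
    resolventOp (hamiltonian A w) z (A (delta y) + ((v y : ℂ) - z) • delta y) =
      delta y + ((v y : ℂ) - w y) • resolventOp (hamiltonian A w) z (delta y) := by
  have hsplit : A (delta y) + ((v y : ℂ) - z) • delta y =
      (A (delta y) + ((w y : ℂ) - z) • delta y) + ((v y : ℂ) - w y) • delta y := by module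
  rw [hsplit, map_add, map_smul, ← (solves_delta A w z y).eq_resolventOp hA hz]

theorem tendsto_resolventOp_apply_delta_image (hA : IsSelfAdjoint A) (hz : z.im ≠ 0) (v : G → ℝ)
    (y : G) :
    Tendsto
      (fun w => resolventOp (hamiltonian A w) z (A (delta y) + ((v y : ℂ) - z) • delta y)) (𝓝 v)
      (𝓝 (resolventOp (hamiltonian A v) z (A (delta y) + ((v y : ℂ) - z) • delta y))) := by
  have hcoeff : Tendsto (fun w : G → ℝ => (v y : ℂ) - w y) (𝓝 v) (𝓝 0) :=
    Continuous.tendsto' (by fun_prop) _ _ (sub_self _)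
  have hbdd : IsBoundedUnder (· ≤ ·) (𝓝 v)
      (norm ∘ fun w => resolventOp (hamiltonian A w) z (delta y)) :=
    isBoundedUnder_of ⟨_, fun w => norm_resolventOp_apply_le hA hz w (delta y)⟩
  simp only [resolventOp_apply_delta_image hA hz, sub_self, zero_smul]
  exact (hcoeff.zero_smul_isBoundedUnder_le hbdd).const_add (delta y)

theorem dense_span_delta_image (hA : IsSelfAdjoint A) (hz : z.im ≠ 0) (v : G → ℝ) :
    Dense (Submodule.span ℂ (Set.range fun y => A (delta y) + ((v y : ℂ) - z) • delta y) :
      Set (Ell2 G)) := by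
  rw [Submodule.dense_iff_topologicalClosure_eq_top, Submodule.topologicalClosure_eq_top_iff,
    Submodule.eq_bot_iff]
  intro χ hχ
  have hsol : Solves A v ((starRingEnd ℂ) z) 0 χ := fun y => by
    have horth := (Submodule.mem_orthogonal _ _).1 hχ _ (Submodule.subset_span ⟨y, rfl⟩)
    have hsymm : inner ℂ (A (delta y)) χ = inner ℂ (delta y) (A χ) := hA.isSymmetric (delta y) χ
    rw [inner_add_left, inner_smul_left, hsymm, inner_delta_left, inner_delta_left, map_sub,
      Complex.conj_ofReal] at horth
    rw [lp.coeFn_zero, Pi.zero_apply]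
    linear_combination horth
  rw [hsol.eq_resolventOp hA (by simpa using hz), map_zero]

theorem continuous_resolventOp_apply (hA : IsSelfAdjoint A) (hz : z.im ≠ 0) (φ : Ell2 G) :
    Continuous fun v : G → ℝ => resolventOp (hamiltonian A v) z φ := by
  rw [continuous_iff_continuousAt]
  intro v
  let R (w : G → ℝ) : Ell2 G →L[ℂ] Ell2 G := resolventOp (hamiltonian A w) z
  let S : Submodule ℂ (Ell2 G) :=
    { carrier := {χ | Tendsto (fun w => R w χ) (𝓝 v) (𝓝 (R v χ))}
      add_mem' := fun h h' => by simpa only [Set.mem_ofPred_eq, map_add] using h.add h'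
      zero_mem' := by simpa only [Set.mem_ofPred_eq, map_zero] using tendsto_const_nhds
      smul_mem' := fun c _ h => by simpa only [Set.mem_ofPred_eq, map_smul] using h.const_smul c }
  have hlip (w : G → ℝ) : LipschitzWith ⟨|z.im|⁻¹, by positivity⟩ (R w) :=
    AddMonoidHomClass.lipschitz_of_bound_nnnorm (R w) _ (norm_resolventOp_apply_le hA hz w)
  have hclosed : IsClosed (S : Set (Ell2 G)) :=
    (LipschitzWith.uniformEquicontinuous _ _ hlip).equicontinuous.isClosed_setOfPred_tendsto
      (R v).continuous
  have hgen : Set.range (fun y => A (delta y) + ((v y : ℂ) - z) • delta y) ⊆ S := by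
    rintro _ ⟨y, rfl⟩
    exact tendsto_resolventOp_apply_delta_image hA hz v y
  exact hclosed.closure_subset_iff.2 (Submodule.span_le.2 hgen) (dense_span_delta_image hA hz v φ)

theorem measurable_greenSqSum [Countable G] (hA : IsSelfAdjoint A) (x : G) (E : ℝ) {η : ℝ}
    (hη : η ≠ 0) : Measurable fun v : G → ℝ => greenSqSum A v x E η := by
  simp only [greenSqSum_eq_enorm_sq hA _ x E hη]
  exact (continuous_resolventOp_apply hA (by simpa using hη) (delta x)).enorm.measurable.pow_const 2

theorem measurable_gammaFn [Countable G] (hA : IsSelfAdjoint A) (x : G) (E : ℝ) :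
    Measurable fun v : G → ℝ => gammaFn A v x E := by
  obtain ⟨η, -, hη, hlim⟩ := exists_seq_strictAnti_tendsto' (zero_lt_one' ℝ)
  refine measurable_of_tendsto_metrizable
    (fun n => measurable_greenSqSum hA x E (hη n).1.ne') (tendsto_pi_nhds.2 fun v => ?_)
  exact (tendsto_greenSqSum hA v x E).comp
    (tendsto_nhdsWithin_iff.2 ⟨hlim, .of_forall fun n => (hη n).1⟩)

end Measurability

section RankOne

variable {G : Type*} [DecidableEq G] {A : Ell2 G →L[ℂ] Ell2 G} {v : G → ℝ} {z : ℂ}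
  {φ ψ χ : Ell2 G} {y : G} {t : ℝ}

theorem Solves.update (h : Solves A v z φ ψ) (y : G) (t : ℝ) :
    Solves A (Function.update v y t) z (φ + (((t : ℂ) - v y) * ψ y) • delta y) ψ := by
  intro x
  simp only [lp.coeFn_add, lp.coeFn_smul, Pi.add_apply, Pi.smul_apply, smul_eq_mul]
  rcases eq_or_ne x y with rfl | hx
  · rw [Function.update_self, delta_apply_self]
    linear_combination h x
  · rw [Function.update_of_ne hx, delta_apply_of_ne hx]
    linear_combination h x

theorem Solves.exists_update_delta (h : Solves A v z (delta y) χ)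
    (ht : 1 + ((t : ℂ) - v y) * χ y ≠ 0) :
    ∃ ξ, Solves A (Function.update v y t) z (delta y) ξ := by
  have hscaled := (h.update y t).smul (1 + ((t : ℂ) - v y) * χ y)⁻¹
  have hrhs : delta y + (((t : ℂ) - v y) * χ y) • delta y =
      (1 + ((t : ℂ) - v y) * χ y) • delta y := by module
  rw [hrhs, inv_smul_smul₀ ht] at hscaled
  exact ⟨_, hscaled⟩

theorem Solves.exists_update (h : Solves A v z φ ψ) (hχ : Solves A v z (delta y) χ)
    (ht : 1 + ((t : ℂ) - v y) * χ y ≠ 0) : ∃ ξ, Solves A (Function.update v y t) z φ ξ := by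
  obtain ⟨ξ, hξ⟩ := hχ.exists_update_delta ht
  have hsub := (h.update y t).sub (hξ.smul (((t : ℂ) - v y) * ψ y))
  rw [add_sub_cancel_right] at hsub
  exact ⟨_, hsub⟩

theorem Solves.exists_solves_delta (h : Solves A v z φ ψ)
    (h' : Solves A (Function.update v y t) z φ χ) (ht : t ≠ v y) (hy : χ y ≠ 0) :
    ∃ ξ, Solves A v z (delta y) ξ := by
  have hc : ((v y : ℂ) - t) * χ y ≠ 0 :=
    mul_ne_zero (sub_ne_zero.2 (by exact_mod_cast ht.symm)) hy
  have hback := h'.update y (v y)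
  rw [Function.update_idem, Function.update_eq_self, Function.update_self] at hback
  have hdiff := (hback.sub h).smul (((v y : ℂ) - t) * χ y)⁻¹
  rw [add_sub_cancel_left, inv_smul_smul₀ hc] at hdiff
  exact ⟨_, hdiff⟩

theorem Solves.subsingleton_update_of_delta (h : Solves A v z φ ψ)
    (hχ : Solves A v z (delta y) χ) :
    {t | ¬ ∃ ξ, Solves A (Function.update v y t) z φ ξ}.Subsingleton := by
  have hroot {t : ℝ} (ht : ¬ ∃ ξ, Solves A (Function.update v y t) z φ ξ) :
      1 + ((t : ℂ) - v y) * χ y = 0 :=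
    not_not.1 fun hne => ht (h.exists_update hχ hne)
  intro s hs t ht
  have hχy : χ y ≠ 0 := fun h0 => by simpa [h0] using hroot hs
  have hst : ((s : ℂ) - t) * χ y = 0 := by linear_combination hroot hs - hroot ht
  exact_mod_cast sub_eq_zero.1 ((mul_eq_zero.1 hst).resolve_right hχy)

theorem Solves.subsingleton_update (h : Solves A v z φ ψ)
    (h' : Solves A (Function.update v y t) z φ χ) (ht : t ≠ v y) :
    {t | ¬ ∃ ξ, Solves A (Function.update v y t) z φ ξ}.Subsingleton := by
  rcases eq_or_ne (χ y) 0 with hy | hy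
  · have hall (s : ℝ) : Solves A (Function.update v y s) z φ χ := by
      simpa [hy] using h'.update y s
    exact fun s hs => absurd ⟨χ, hall s⟩ hs
  · obtain ⟨ξ, hξ⟩ := h.exists_solves_delta h' ht hy
    exact h.subsingleton_update_of_delta hξ

/-- Along each line parallel to a coordinate axis, either at most one point belongs to `D` or at
most one point does not. -/
def TrivialOnLines (D : Set (G → ℝ)) : Prop :=
  ∀ (y : G) (v : G → ℝ), {t | Function.update v y t ∈ D}.Subsingleton ∨
    {t | Function.update v y t ∉ D}.Subsingleton

theorem trivialOnLines_setOf_exists_solves (A : Ell2 G →L[ℂ] Ell2 G) (z : ℂ) (φ : Ell2 G) :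
    TrivialOnLines {v | ∃ ψ, Solves A v z φ ψ} := by
  intro y v
  refine or_iff_not_imp_left.2 fun hnot => ?_
  obtain ⟨a, ⟨ψ, hψ⟩, b, ⟨χ, hχ⟩, hab⟩ := Set.not_subsingleton_iff.1 hnot
  rw [← Function.update_idem a b v] at hχ
  simpa only [Function.update_idem, Set.mem_ofPred_eq] using
    hψ.subsingleton_update hχ (by simpa using hab.symm)

end RankOne

section EraseCoord

variable {G : Type*} [DecidableEq G] {D : Set (G → ℝ)} {y : G} {v : G → ℝ}

/-- A version of `D` that does not depend on the coordinate `y`. For `D` trivial on lines it selects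
those lines in direction `y` of which at most one point is missing from `D`; testing only integer
values of the coordinate keeps the definition measurable. -/
def eraseCoord (y : G) (D : Set (G → ℝ)) : Set (G → ℝ) :=
  {v | ∀ᶠ n : ℕ in atTop, Function.update v y n ∈ D}

theorem update_mem_eraseCoord_iff {t : ℝ} :
    Function.update v y t ∈ eraseCoord y D ↔ v ∈ eraseCoord y D := by
  simp only [eraseCoord, Set.mem_ofPred_eq, Function.update_idem]

theorem eventually_natCast_notMem {s : Set ℝ} (hs : s.Finite) : ∀ᶠ n : ℕ in atTop, (n : ℝ) ∉ s := by
  rw [← Nat.cofinite_eq_atTop]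
  exact Nat.cast_injective.tendsto_cofinite.eventually hs.eventually_cofinite_notMem

theorem TrivialOnLines.subsingleton_of_mem (hD : TrivialOnLines D) (hv : v ∈ eraseCoord y D) :
    {t | Function.update v y t ∉ D}.Subsingleton := by
  refine (hD y v).resolve_left fun h => ?_
  obtain ⟨n, hn, hn'⟩ := (hv.and (eventually_natCast_notMem h.finite)).exists
  exact hn' hn

theorem TrivialOnLines.subsingleton_of_notMem (hD : TrivialOnLines D) (hv : v ∉ eraseCoord y D) :
    {t | Function.update v y t ∈ D}.Subsingleton :=
  (hD y v).resolve_right fun h => hv <|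
    (eventually_natCast_notMem h.finite).mono fun _ => not_not.1

theorem TrivialOnLines.eventually_notMem (hD : TrivialOnLines D) (hv : v ∉ eraseCoord y D) :
    ∀ᶠ n : ℕ in atTop, Function.update v y n ∉ D :=
  eventually_natCast_notMem (hD.subsingleton_of_notMem hv).finite

theorem TrivialOnLines.eraseCoord (hD : TrivialOnLines D) (y : G) :
    TrivialOnLines (eraseCoord y D) := by
  intro i v
  rcases eq_or_ne i y with rfl | hi
  · by_cases hv : v ∈ SimonWolff.eraseCoord i D <;> simp [update_mem_eraseCoord_iff, hv]
  by_contra! hcon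
  obtain ⟨⟨a, ha, b, hb, hab⟩, c, hc, d, hd, hcd⟩ := hcon
  -- A single integer value of the coordinate `y` witnesses all four memberships.
  obtain ⟨n, ⟨han, hbn⟩, hcn, hdn⟩ := ((ha.and hb).and
    ((hD.eventually_notMem hc).and (hD.eventually_notMem hd))).exists
  rw [Function.update_comm hi] at han hbn hcn hdn
  rcases hD i (Function.update v y n) with h | h
  · exact hab (h han hbn)
  · exact hcd (h hcn hdn)

theorem measurableSet_eraseCoord {Δ : Set G} (hD : MeasurableSet[cylinderEvents Δ] D) (y : G) :
    MeasurableSet[cylinderEvents (Δ \ {y})] (eraseCoord y D) := by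
  have hupdate (t : ℝ) : Measurable[cylinderEvents (Δ \ {y}), cylinderEvents Δ]
      fun v : G → ℝ => Function.update v y t := by
    refine measurable_cylinderEvents_iff.2 fun z hz => ?_
    rcases eq_or_ne z y with rfl | hzy
    · simp only [Function.update_self, measurable_const]
    · simpa only [Function.update_of_ne hzy] using
        measurable_cylinderEvent_apply (show z ∈ Δ \ {y} from ⟨hz, hzy⟩)
  have heq : eraseCoord y D = liminf (fun n : ℕ => (Function.update · y (n : ℝ)) ⁻¹' D) atTop := by
    ext v
    simp only [mem_liminf_iff_eventually_mem, eraseCoord, Set.mem_ofPred_eq, Set.mem_preimage]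
  rw [heq]
  exact @MeasurableSet.measurableSet_liminf _ (cylinderEvents (Δ \ {y})) _ fun n => hupdate n hD

/-- The version of `D` obtained by erasing successively the coordinates `e 0`, …, `e (n - 1)`. -/
def eraseCoords (e : ℕ → G) (D : Set (G → ℝ)) : ℕ → Set (G → ℝ)
  | 0 => D
  | n + 1 => eraseCoord (e n) (eraseCoords e D n)

theorem TrivialOnLines.eraseCoords (hD : TrivialOnLines D) (e : ℕ → G) (n : ℕ) :
    TrivialOnLines (eraseCoords e D n) := by
  induction n with
  | zero => exact hD
  | succ n ih => exact ih.eraseCoord (e n)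

theorem measurableSet_eraseCoords (hD : MeasurableSet D) (e : ℕ → G) (n : ℕ) :
    MeasurableSet[cylinderEvents (e '' Set.Iio n)ᶜ] (eraseCoords e D n) := by
  induction n with
  | zero =>
    have huniv : (e '' Set.Iio 0)ᶜ = Set.univ := by simp
    rwa [huniv, cylinderEvents_univ]
  | succ n ih =>
    have hcompl : (e '' Set.Iio (n + 1))ᶜ = (e '' Set.Iio n)ᶜ \ {e n} := by
      rw [← Order.succ_eq_add_one, Order.Iio_succ_eq_insert, Set.image_insert_eq,
        ← Set.union_singleton, Set.compl_union, Set.sdiff_eq]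
    rw [hcompl]
    exact measurableSet_eraseCoord ih (e n)

end EraseCoord

section ZeroOne

variable {G Ω : Type*} {V : G → Ω → ℝ}

theorem measurable_sigmaOn_cylinderEvents (V : G → Ω → ℝ) (Λ : Set G) :
    Measurable[sigmaOn V Λ, cylinderEvents Λ] fun ω z => V z ω := by
  let _ : MeasurableSpace Ω := sigmaOn V Λ
  exact measurable_cylinderEvents_iff.2 fun z hz =>
    (comap_measurable (V z)).mono (le_iSup₂_of_le z hz le_rfl) le_rfl

theorem measurableSet_limsup_preimage_eraseCoords [DecidableEq G] {D : Set (G → ℝ)}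
    (hD : MeasurableSet D) {e : ℕ → G} (he : Function.Surjective e) {Λ : Set G} (hΛ : Λ.Finite) :
    MeasurableSet[sigmaOn V Λᶜ]
      (limsup (fun n => (fun ω z => V z ω) ⁻¹' eraseCoords e D n) atTop) := by
  obtain ⟨m, hm⟩ : ∃ m, Λ ⊆ e '' Set.Iio m := by
    obtain ⟨m, hm⟩ := (hΛ.image (Function.surjInv he)).bddAbove
    exact ⟨m + 1, fun z hz => ⟨Function.surjInv he z, Nat.lt_succ_of_le (hm ⟨z, hz, rfl⟩),
      Function.surjInv_eq he z⟩⟩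
  rw [← limsup_nat_add _ m]
  refine @MeasurableSet.measurableSet_limsup _ (sigmaOn V Λᶜ) _ fun n => ?_
  have hsub : (e '' Set.Iio (n + m))ᶜ ⊆ Λᶜ := Set.compl_subset_compl.2 <|
    hm.trans (Set.image_mono (Set.Iio_subset_Iio (Nat.le_add_left m n)))
  exact measurable_sigmaOn_cylinderEvents V Λᶜ
    (cylinderEvents_mono hsub _ (measurableSet_eraseCoords hD e (n + m)))

variable [MeasurableSpace Ω] {P : Measure Ω}

theorem HasKProperty.measure_eq_zero_or_one [IsProbabilityMeasure P] (hK : HasKProperty V P)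
    {T : Set Ω} (hT : ∀ Λ : Set G, Λ.Finite → MeasurableSet[sigmaOn V Λᶜ] T) :
    P T = 0 ∨ P T = 1 := by
  obtain ⟨c, hc⟩ := hK (T.indicator 1) fun Λ hΛ =>
    (@measurable_one ℝ Ω _ (sigmaOn V Λᶜ) _).indicator (hT Λ hΛ)
  rcases eq_or_ne c 0 with rfl | hc0
  · left
    rw [measure_eq_zero_iff_ae_notMem]
    filter_upwards [hc] with ω hω hmem
    simp [hmem] at hω
  · right
    rw [← measure_univ (μ := P)]
    refine measure_congr (eventuallyEq_univ.2 ?_)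
    filter_upwards [hc] with ω hω
    exact Set.mem_of_indicator_ne_zero (hω ▸ hc0)

variable [IsFiniteMeasure P] [DecidableEq G]

theorem measure_preimage_eq_lintegral_condDistrib (hV : ∀ x, Measurable (V x)) (y : G)
    {N : Set (G → ℝ)} (hN : MeasurableSet N) :
    P ((fun ω z => V z ω) ⁻¹' N) =
      ∫⁻ ω, condDistrib (V y) (fun ω' (z : {z : G // z ≠ y}) => V z ω') P (fun z => V z ω)
        {t | Function.update (fun z => V z ω) y t ∈ N} ∂P := by
  let glue (p : ({z : G // z ≠ y} → ℝ) × ℝ) : G → ℝ := (Equiv.funSplitAt y ℝ).symm p.swap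
  let X (ω : Ω) (z : {z : G // z ≠ y}) : ℝ := V z ω
  have hX : Measurable X := measurable_pi_iff.2 fun z => hV z
  have hglue : Measurable glue := by
    refine measurable_pi_iff.2 fun z => ?_
    rcases eq_or_ne z y with rfl | hz
    · simpa [glue] using measurable_snd
    · simpa [glue, hz, Function.comp_def] using
        (measurable_pi_apply (⟨z, hz⟩ : {z // z ≠ y})).comp measurable_fst
  have hglue_apply (ω : Ω) (t : ℝ) :
      glue (X ω, t) = Function.update (fun z => V z ω) y t := by
    ext z
    rcases eq_or_ne z y with rfl | hz
    · simp [glue]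
    · simp [glue, X, hz]
  have hpre : (fun ω z => V z ω) ⁻¹' N = (fun ω => (X ω, V y ω)) ⁻¹' (glue ⁻¹' N) := by
    ext ω
    simp only [Set.mem_preimage, hglue_apply, Function.update_eq_self_iff.2 rfl]
  have hS : MeasurableSet (glue ⁻¹' N) := hglue hN
  simp only [← hglue_apply]
  rw [hpre, ← Measure.map_apply (hX.prodMk (hV y)) hS,
    ← compProd_map_condDistrib (X := X) (hV y).aemeasurable, Measure.compProd_apply hS,
    lintegral_map (Kernel.measurable_kernel_prodMk_left hS) hX]
  rfl

theorem measure_preimage_eq_zero_of_countable (hV : ∀ x, Measurable (V x))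
    (hcont : HasContinuousConditionalLaws V P) (y : G) {N : Set (G → ℝ)} (hN : MeasurableSet N)
    (hcount : ∀ v, {t | Function.update v y t ∈ N}.Countable) :
    P ((fun ω z => V z ω) ⁻¹' N) = 0 := by
  rw [measure_preimage_eq_lintegral_condDistrib hV y hN]
  refine (lintegral_congr_ae ?_).trans lintegral_zero
  filter_upwards [hcont y] with ω hω
  have : NullSingletonClass (condDistrib (V y) (fun ω' (z : {z : G // z ≠ y}) => V z ω') P
    (fun z => V z ω)) := ⟨hω⟩
  exact (hcount _).measure_zero _

theorem preimage_eraseCoord_ae_eq (hV : ∀ x, Measurable (V x))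
    (hcont : HasContinuousConditionalLaws V P) {D : Set (G → ℝ)} (hD : MeasurableSet D)
    (htriv : TrivialOnLines D) (y : G) :
    (fun ω z => V z ω) ⁻¹' eraseCoord y D =ᵐ[P] (fun ω z => V z ω) ⁻¹' D := by
  have hD' : MeasurableSet (eraseCoord y D) :=
    cylinderEvents_le_pi _ (measurableSet_eraseCoord (Δ := Set.univ)
      (by rwa [cylinderEvents_univ]) y)
  rw [← measure_symmDiff_eq_zero_iff, ← Set.preimage_symmDiff]
  refine measure_preimage_eq_zero_of_countable hV hcont y (hD'.symmDiff hD) fun v => ?_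
  by_cases hv : v ∈ eraseCoord y D
  · simpa [Set.mem_symmDiff, update_mem_eraseCoord_iff, hv] using
      (htriv.subsingleton_of_mem hv).countable
  · simpa [Set.mem_symmDiff, update_mem_eraseCoord_iff, hv] using
      (htriv.subsingleton_of_notMem hv).countable

theorem preimage_eraseCoords_ae_eq (hV : ∀ x, Measurable (V x))
    (hcont : HasContinuousConditionalLaws V P) {D : Set (G → ℝ)} (hD : MeasurableSet D)
    (htriv : TrivialOnLines D) (e : ℕ → G) (n : ℕ) :
    (fun ω z => V z ω) ⁻¹' eraseCoords e D n =ᵐ[P] (fun ω z => V z ω) ⁻¹' D := by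
  induction n with
  | zero => rfl
  | succ n ih =>
    have hDn := cylinderEvents_le_pi _ (measurableSet_eraseCoords hD e n)
    exact (preimage_eraseCoord_ae_eq hV hcont hDn (htriv.eraseCoords e n) (e n)).trans ih

theorem measure_eq_zero_or_one_of_trivialOnLines [Countable G] [Nonempty G]
    {P : Measure Ω} [IsProbabilityMeasure P] (hV : ∀ x, Measurable (V x))
    (hK : HasKProperty V P) (hcont : HasContinuousConditionalLaws V P) {D : Set (G → ℝ)}
    (hD : MeasurableSet D) (htriv : TrivialOnLines D) :
    P ((fun ω z => V z ω) ⁻¹' D) = 0 ∨ P ((fun ω z => V z ω) ⁻¹' D) = 1 := by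
  obtain ⟨e, he⟩ := exists_surjective_nat G
  rw [← measure_congr (limsup_ae_eq_of_forall_ae_eq _
    (preimage_eraseCoords_ae_eq hV hcont hD htriv e))]
  exact hK.measure_eq_zero_or_one fun _ hΛ =>
    measurableSet_limsup_preimage_eraseCoords hD he hΛ

end ZeroOne

end SimonWolff

theorem theorem2p1_general {G Ω : Type*} [Countable G] [MeasurableSpace Ω]
    (P : Measure Ω) [IsProbabilityMeasure P]
    (A : SimonWolff.Ell2 G →L[ℂ] SimonWolff.Ell2 G) (hA : IsSelfAdjoint A)
    (V : G → Ω → ℝ) (hV : ∀ x, Measurable (V x))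
    (hK : SimonWolff.HasKProperty V P)
    (hcont : SimonWolff.HasContinuousConditionalLaws V P)
    (x : G) :
    (∀ (ω : Ω) (E : ℝ),
      Tendsto (fun η : ℝ => SimonWolff.greenSqSum A (fun y => V y ω) x E η) (𝓝[>] 0)
        (𝓝 (SimonWolff.gammaFn A (fun y => V y ω) x E))) ∧
    (∀ E : ℝ, MeasurableSet {ω | SimonWolff.gammaFn A (fun y => V y ω) x E < ∞}) ∧
    ∀ E : ℝ,
      P {ω | SimonWolff.gammaFn A (fun y => V y ω) x E < ∞} = 0 ∨
        P {ω | SimonWolff.gammaFn A (fun y => V y ω) x E < ∞} = 1 := by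
  classical
  have : Nonempty G := ⟨x⟩
  let D (E : ℝ) : Set (G → ℝ) := {v | SimonWolff.gammaFn A v x E < ∞}
  have hD (E : ℝ) : MeasurableSet (D E) :=
    measurableSet_lt (SimonWolff.measurable_gammaFn hA x E) measurable_const
  have htriv (E : ℝ) : SimonWolff.TrivialOnLines (D E) := by
    simpa only [D, SimonWolff.gammaFn_lt_top_iff hA] using
      SimonWolff.trivialOnLines_setOf_exists_solves A E (SimonWolff.delta x)
  exact ⟨fun ω E => SimonWolff.tendsto_greenSqSum hA _ x E,
    fun E => measurable_pi_iff.2 hV (hD E),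
    fun E => SimonWolff.measure_eq_zero_or_one_of_trivialOnLines hV hK hcont (hD E) (htriv E)⟩

theorem theorem2p1 {G Ω : Type*} [Countable G] [MeasurableSpace Ω]
    (P : Measure Ω) [IsProbabilityMeasure P]
    (A : SimonWolff.Ell2 G →L[ℂ] SimonWolff.Ell2 G) (hA : IsSelfAdjoint A)
    (V : G → Ω → ℝ) (hV : ∀ x, Measurable (V x))
    (hK : SimonWolff.HasKProperty V P)
    (hcont : SimonWolff.HasContinuousConditionalLaws V P)
    (x : G) :
    (∀ (ω : Ω) (E : ℝ),
      Tendsto (fun η : ℝ => SimonWolff.greenSqSum A (fun y => V y ω) x E η) (𝓝[>] 0)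
        (𝓝 (SimonWolff.gammaFn A (fun y => V y ω) x E))) ∧
    (∀ E : ℝ, MeasurableSet {ω | SimonWolff.gammaFn A (fun y => V y ω) x E < ∞}) ∧
    ∀ᵐ E : ℝ,
      P {ω | SimonWolff.gammaFn A (fun y => V y ω) x E < ∞} = 0 ∨
        P {ω | SimonWolff.gammaFn A (fun y => V y ω) x E < ∞} = 1 :=
  let ⟨htendsto, hmeas, hzero_one⟩ := theorem2p1_general P A hA V hV hK hcont x
  ⟨htendsto, hmeas, .of_forall hzero_one⟩
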